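/- Let $N\ge 1$, let $A,B\in\mathbb{R}^{n\times n}$ with $B$ nonsingular, and suppose that all (complex) eigenvalues of $A$ lie on the imaginary axis. For $t\ge 0$ let $\mathcal G(t)$ be a weighted digraph on the nodes $v_1,\dots,v_N$ with adjacency weights $a_{kj}(t)\ge 0$, $a_{kk}(t)=0$, and Laplacian $L(t)$ given by $l_{kk}(t)=\sum_i a_{ki}(t)$ and $l_{kj}(t)=-a_{kj}(t)$ for $j\ne k$. Assume that $L$ is bounded and piecewise continuous on $[0,\infty)$ (finitely many discontinuities in each bounded interval, all one-sided limits exist), and that $\mathcal G$ is uniformly connected: there are $T>0$, $\delta>0$ and an index $k$ such that for every $t\ge 0$ and every $j\ne k$ there is a path from $v_j$ to $v_k$ in the digraph having an edge from $v_p$ to $v_q$ if and only if $\int_t^{t+T}a_{pq}(\tau)\,d\tau\ge\delta$. Consider the $N$ systems $\dot x_k=Ax_k+Bu_k$ with the control law $$u_k=B^{-1}\sum_{j=1}^N a_{kj}(t)(x_j-x_k),\qquad k=1,\dots,N.$$ Then the control law exponentially synchronizes all solutions to a solution of $\dot x_0=Ax_0$: there are constants $c>0$ and $r>0$ such that for every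 $t_0\ge 0$ and every solution $(x_1,\dots,x_N)$ of the closed-loop system on $[t_0,\infty)$ (continuous, and satisfying the differential equations for $t>t_0$ except at times of which each bounded interval contains finitely many) there is a solution $x_0$ of $\dot x_0=Ax_0$ with $$\Big(\sum_{k=1}^N\|x_k(t)-x_0(t)\|^2\Big)^{1/2}\le c\,e^{-r(t-t_0)}\Big(\sum_{k=1}^N\|x_k(t_0)-x_0(t_0)\|^2\Big)^{1/2}\qquad\text{for all } t\ge t_0 .$$ -/

import Mathlib

open Set Filter Topology

/-- A function of time is piecewise continuous on `[0, ∞)`: it has finitely many points of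
discontinuity in each bounded interval, and all one-sided limits exist. -/
def PiecewiseContinuous {X : Type*} [TopologicalSpace X] (f : ℝ → X) : Prop :=
  (∀ b : ℝ, {t : ℝ | 0 ≤ t ∧ t ≤ b ∧ ¬ ContinuousWithinAt f (Ici 0) t}.Finite) ∧
  (∀ t : ℝ, 0 ≤ t → ∃ l : X, Tendsto f (𝓝[>] t) (𝓝 l)) ∧
  (∀ t : ℝ, 0 < t → ∃ l : X, Tendsto f (𝓝[<] t) (𝓝 l))

/-- A time-varying weighted digraph on the nodes `Fin N`, for times `t ≥ 0`, given by its weighted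
adjacency matrix: nonnegative weights and no self-cycles. There is an edge from `k` to `j`
(system `k` receives information from system `j`) when `adj t k j` is positive. -/
structure TimeVaryingDigraph (N : ℕ) where
  adj : ℝ → Matrix (Fin N) (Fin N) ℝ
  adj_nonneg : ∀ t : ℝ, 0 ≤ t → ∀ k j, 0 ≤ adj t k j
  adj_self : ∀ t : ℝ, 0 ≤ t → ∀ k, adj t k k = 0

namespace TimeVaryingDigraph

variable {N : ℕ}

/-- The Laplacian matrix at time `t`. -/
def laplacian (G : TimeVaryingDigraph N) (t : ℝ) : Matrix (Fin N) (Fin N) ℝ :=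
  Matrix.of fun k j => if j = k then ∑ i, G.adj t k i else - G.adj t k j

/-- The Laplacian is bounded on `[0, ∞)`. -/
def LaplacianBounded (G : TimeVaryingDigraph N) : Prop :=
  ∃ M : ℝ, ∀ t : ℝ, 0 ≤ t → ∀ k j, |G.laplacian t k j| ≤ M

/-- `j` is a neighbour of `k` across `[ta, tb]`: in the weighted digraph with adjacency matrix
`∫ τ in ta..tb, adj τ`, the weight from `k` to `j` is at least the threshold `δ`. -/
def NeighborAcross (G : TimeVaryingDigraph N) (δ ta tb : ℝ) (k j : Fin N) : Prop :=
  δ ≤ ∫ τ in ta..tb, G.adj τ k j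

/-- `k` is connected to `j` across `[ta, tb]`: there is a path from `k` to `j`, each vertex of which
is followed by one of its neighbours across `[ta, tb]`. -/
def ConnectedAcross (G : TimeVaryingDigraph N) (δ ta tb : ℝ) (k j : Fin N) : Prop :=
  Relation.ReflTransGen (G.NeighborAcross δ ta tb) k j

/-- Uniform connectivity: there are a time horizon `T > 0`, a threshold `δ > 0` and a node `k` such
that, for every `t ≥ 0`, every other node is connected to `k` across `[t, t + T]`. -/
def UniformlyConnected (G : TimeVaryingDigraph N) : Prop :=
  ∃ T : ℝ, 0 < T ∧ ∃ δ : ℝ, 0 < δ ∧ ∃ k : Fin N,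
    ∀ t : ℝ, 0 ≤ t → ∀ j : Fin N, j ≠ k → G.ConnectedAcross δ t (t + T) j k

end TimeVaryingDigraph

/-- All (complex) eigenvalues of the real matrix `A` lie on the imaginary axis. -/
def EigenvaluesImaginary {n : ℕ} (A : Matrix (Fin n) (Fin n) ℝ) : Prop :=
  ∀ μ : ℂ, Module.End.HasEigenvalue (Matrix.toLin' (A.map (algebraMap ℝ ℂ))) μ → μ.re = 0

/-- `x` is a solution on `[t₀, ∞)` of `ẋ = A x + B u`: it is continuous and satisfies the equation
at every time `t > t₀` outside a set with finitely many points in each bounded interval. -/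
def IsControlledSolution {n m : ℕ} (A : Matrix (Fin n) (Fin n) ℝ) (B : Matrix (Fin n) (Fin m) ℝ)
    (u : ℝ → EuclideanSpace ℝ (Fin m)) (t₀ : ℝ) (x : ℝ → EuclideanSpace ℝ (Fin n)) : Prop :=
  ContinuousOn x (Ici t₀) ∧
  ∃ D : Set ℝ, (∀ b : ℝ, (D ∩ Icc t₀ b).Finite) ∧
    ∀ t : ℝ, t₀ < t → t ∉ D →
      HasDerivAt x (Matrix.toEuclideanLin A (x t) + Matrix.toEuclideanLin B (u t)) t

/-- `x₀` is a solution (for all times) of the open-loop system `ẋ₀ = A x₀`. -/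
def IsOpenLoopSolution {n : ℕ} (A : Matrix (Fin n) (Fin n) ℝ)
    (x₀ : ℝ → EuclideanSpace ℝ (Fin n)) : Prop :=
  ∀ t : ℝ, HasDerivAt x₀ (Matrix.toEuclideanLin A (x₀ t)) t

/-- The control law `u_k = B⁻¹ ∑ j, a_kj(t) (x_j - x_k)`, as a function of time along `x`. -/
noncomputable def diffusiveControl {N n : ℕ} (B : Matrix (Fin n) (Fin n) ℝ)
    (G : TimeVaryingDigraph N) (x : Fin N → ℝ → EuclideanSpace ℝ (Fin n)) (k : Fin N) (t : ℝ) :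
    EuclideanSpace ℝ (Fin n) :=
  Matrix.toEuclideanLin B⁻¹ (∑ j, G.adj t k j • (x j t - x k t))

/-- `x = (x_1, …, x_N)` is a solution on `[t₀, ∞)` of the `N` systems `ẋ_k = A x_k + B u_k` in
closed loop with the control law. -/
def IsClosedLoopSolution {N n : ℕ} (A B : Matrix (Fin n) (Fin n) ℝ)
    (G : TimeVaryingDigraph N) (t₀ : ℝ) (x : Fin N → ℝ → EuclideanSpace ℝ (Fin n)) : Prop :=
  ∀ k, IsControlledSolution A B (diffusiveControl B G x k) t₀ (x k)

/-- The Euclidean norm of the stacked vector `(v_1, …, v_N)`. -/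
noncomputable def stackNorm {N n : ℕ} (v : Fin N → EuclideanSpace ℝ (Fin n)) : ℝ :=
  Real.sqrt (∑ k, ‖v k‖ ^ 2)

/-! The substitution `w_k(t) = e^{-(t-t₀)A} x_k(t)` removes the drift: `B B⁻¹ = 1`, and the
exponential is linear, common to all nodes and commutes with `A`. Hence every coordinate of `w`
solves the scalar consensus equations `ẏ_k = ∑ j, a_kj (y_j - y_k)`, with rates independent of the
coordinate.

For these, `min y` never decreases and `max y` never increases. If the root lies in the upper half
of `[min y, max y]`, its height above the minimum decays at most like `e^{-Kt}` and leaks along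
edges of integrated weight `≥ δ`. Each window of length `T` lifts at least one further node, so
after `N` windows the minimum has risen by a fixed fraction of the diameter
(`exists_finset_spread`). If the root lies in the lower half, the same applies to `-y`. So the
diameter contracts geometrically, at some rate `r` (`exists_consensus`).

Transforming back costs a factor `‖e^{(t-t₀)A}‖`. It may grow, since `A` can have Jordan blocks, but
by Gelfand's formula it is `O(e^{ε(t-t₀)})` for every `ε > 0` (`exists_norm_exp_smul_le`). Taking `ε
= r/2` leaves the rate `r/2`. -/

open MeasureTheory in
/-- Fundamental inequality of calculus with finitely many exceptional points. -/
theorem integral_le_sub_of_hasDerivAt_off_finite {f f' φ : ℝ → ℝ} {s : Set ℝ} (hs : s.Finite)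
    {a b : ℝ} (hab : a ≤ b) (hf : ContinuousOn f (Icc a b))
    (hf' : ∀ t ∈ Ioo a b, t ∉ s → HasDerivAt f (f' t) t)
    (hφ : IntegrableOn φ (Icc a b)) (hle : ∀ t ∈ Ioo a b, φ t ≤ f' t) :
    ∫ t in a..b, φ t ≤ f b - f a := by
  induction s, hs using Set.Finite.induction_on generalizing a b with
  | empty =>
    exact intervalIntegral.integral_le_sub_of_hasDeriv_right_of_le hab hf
      (fun t ht => (hf' t ht (by simp)).hasDerivWithinAt) hφ hle
  | @insert p s _ _ ih =>
    -- An exceptional point inside the interval splits it in two; one outside imposes nothing.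
    by_cases hp : p ∈ Ioo a b
    · have hl : Icc a p ⊆ Icc a b := Icc_subset_Icc le_rfl hp.2.le
      have hr : Icc p b ⊆ Icc a b := Icc_subset_Icc hp.1.le le_rfl
      have h1 := ih hp.1.le (hf.mono hl)
        (fun t ht hts => hf' t ⟨ht.1, ht.2.trans hp.2⟩ (by simp [hts, ht.2.ne]))
        (hφ.mono_set hl) (fun t ht => hle t ⟨ht.1, ht.2.trans hp.2⟩)
      have h2 := ih hp.2.le (hf.mono hr)
        (fun t ht hts => hf' t ⟨hp.1.trans ht.1, ht.2⟩ (by simp [hts, ht.1.ne']))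
        (hφ.mono_set hr) (fun t ht => hle t ⟨hp.1.trans ht.1, ht.2⟩)
      have h3 := intervalIntegral.integral_add_adjacent_intervals
        ((intervalIntegrable_iff_integrableOn_Icc_of_le hp.1.le).2 (hφ.mono_set hl))
        ((intervalIntegrable_iff_integrableOn_Icc_of_le hp.2.le).2 (hφ.mono_set hr))
      linarith
    · exact ih hab hf (fun t ht hts => hf' t ht (by
        rintro (rfl | h)
        exacts [hp ht, hts h])) hφ hle

/-! ### Scalar consensus: monotone bounds and transfer along an edge -/

/-- `y` solves the scalar consensus equations `ẏ_k = ∑ j, a_kj (y_j - y_k)` on `[t₀, ∞)`, outside a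
set `D` of times. -/
structure IsConsensusSolution {N : ℕ} (a : ℝ → Matrix (Fin N) (Fin N) ℝ) (D : Set ℝ) (t₀ : ℝ)
    (y : Fin N → ℝ → ℝ) : Prop where
  finite : ∀ b : ℝ, (D ∩ Icc t₀ b).Finite
  continuousOn : ∀ k, ContinuousOn (y k) (Ici t₀)
  hasDerivAt : ∀ k t, t₀ < t → t ∉ D → HasDerivAt (y k) (∑ j, a t k j * (y j t - y k t)) t

namespace IsConsensusSolution

variable {N : ℕ} {a : ℝ → Matrix (Fin N) (Fin N) ℝ} {D : Set ℝ} {t₀ : ℝ} {y : Fin N → ℝ → ℝ}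

theorem mono (h : IsConsensusSolution a D t₀ y) {s : ℝ} (hs : t₀ ≤ s) :
    IsConsensusSolution a D s y where
  finite b := (h.finite b).subset (inter_subset_inter_right _ (Icc_subset_Icc_left hs))
  continuousOn k := (h.continuousOn k).mono (Ici_subset_Ici.2 hs)
  hasDerivAt k t ht := h.hasDerivAt k t (hs.trans_lt ht)

theorem neg (h : IsConsensusSolution a D t₀ y) :
    IsConsensusSolution a D t₀ (fun k t => - y k t) where
  finite := h.finite
  continuousOn k := (h.continuousOn k).neg
  hasDerivAt k t ht htD := by
    refine (h.hasDerivAt k t ht htD).fun_neg.congr_deriv ?_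
    rw [← Finset.sum_neg_distrib]
    exact Finset.sum_congr rfl fun j _ => by ring

theorem sub_const (h : IsConsensusSolution a D t₀ y) (c : ℝ) :
    IsConsensusSolution a D t₀ (fun k t => y k t - c) where
  finite := h.finite
  continuousOn k := (h.continuousOn k).sub continuousOn_const
  hasDerivAt k t ht htD := by simpa using (h.hasDerivAt k t ht htD).sub_const c

/-- Along a nonnegative solution, `e^{K t} y_k` grows at least as fast as the integral of any
function below the inflow into node `k`, provided that `K` bounds the total weight at `k`. -/
theorem integral_le_exp_mul_sub (h : IsConsensusSolution a D t₀ y) {K t₁ : ℝ} {k : Fin N}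
    {φ : ℝ → ℝ} (ht : t₀ ≤ t₁) (hK : ∀ t ∈ Ioo t₀ t₁, ∑ j, a t k j ≤ K)
    (hy : ∀ t ∈ Ioo t₀ t₁, 0 ≤ y k t)
    (hφ : MeasureTheory.IntegrableOn φ (Icc t₀ t₁))
    (hle : ∀ t ∈ Ioo t₀ t₁, φ t ≤ Real.exp (K * (t - t₀)) * ∑ j, a t k j * y j t) :
    ∫ t in t₀..t₁, φ t ≤ Real.exp (K * (t₁ - t₀)) * y k t₁ - y k t₀ := by
  have key := integral_le_sub_of_hasDerivAt_off_finite
    (f := fun t => Real.exp (K * (t - t₀)) * y k t)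
    (f' := fun t => Real.exp (K * (t - t₀)) * K * y k t +
      Real.exp (K * (t - t₀)) * ∑ j, a t k j * (y j t - y k t)) (h.finite t₁) ht ?_ ?_ hφ ?_
  · simpa using key
  · exact (Continuous.continuousOn (by fun_prop)).mul
      ((h.continuousOn k).mono Icc_subset_Ici_self)
  · intro t htt htD
    have h1 := h.hasDerivAt k t htt.1 fun hD => htD ⟨hD, htt.1.le, htt.2.le⟩
    have h2 : HasDerivAt (fun t => Real.exp (K * (t - t₀))) (Real.exp (K * (t - t₀)) * K) t := by
      simpa using (((hasDerivAt_id t).sub_const t₀).const_mul K).exp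
    exact h2.mul h1
  · intro t htt
    refine (hle t htt).trans ?_
    have h1 : ∑ j, a t k j * (y j t - y k t) = ∑ j, a t k j * y j t - (∑ j, a t k j) * y k t := by
      rw [Finset.sum_mul, ← Finset.sum_sub_distrib]
      exact Finset.sum_congr rfl fun j _ => by ring
    -- The slack in the differential inequality is `e^{K(t-t₀)} (K - ∑ j, a_kj) y_k ≥ 0`.
    have h2 := mul_nonneg (Real.exp_pos (K * (t - t₀))).le
      (mul_nonneg (sub_nonneg.2 (hK t htt)) (hy t htt))
    simp only [h1]
    linarith

/-- A nonnegative solution decays at most at the rate given by the total weight. -/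
theorem le_exp_mul (h : IsConsensusSolution a D t₀ y) {K t₁ : ℝ} {k : Fin N} (ht : t₀ ≤ t₁)
    (ha : ∀ t ∈ Ioo t₀ t₁, ∀ j, 0 ≤ a t k j) (hK : ∀ t ∈ Ioo t₀ t₁, ∑ j, a t k j ≤ K)
    (hy : ∀ t ∈ Ioo t₀ t₁, ∀ j, 0 ≤ y j t) :
    y k t₀ ≤ Real.exp (K * (t₁ - t₀)) * y k t₁ := by
  have := h.integral_le_exp_mul_sub (φ := fun _ => 0) ht hK (fun t htt => hy t htt k) (by simp)
    fun t htt => mul_nonneg (Real.exp_pos _).le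
      (Finset.sum_nonneg fun j _ => mul_nonneg (ha t htt j) (hy t htt j))
  simpa using this

/-- At the first time `τ` when some component is nonpositive, all components were positive before,
so `le_exp_mul` bounds that component at `τ` below by a positive multiple of its initial value. -/
theorem pos_of_pos (h : IsConsensusSolution a D t₀ y) {K : ℝ}
    (ha : ∀ t, t₀ ≤ t → ∀ k j, 0 ≤ a t k j) (hK : ∀ t, t₀ ≤ t → ∀ k, ∑ j, a t k j ≤ K)
    (h0 : ∀ k, 0 < y k t₀) {t : ℝ} (ht : t₀ ≤ t) (k : Fin N) : 0 < y k t := by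
  by_contra! hk
  have hcl : IsClosed {s ∈ Icc t₀ t | ∃ i, y i s ≤ 0} := by
    have : {s ∈ Icc t₀ t | ∃ i, y i s ≤ 0} = ⋃ i, Icc t₀ t ∩ y i ⁻¹' Iic 0 := by
      ext s; simp
    rw [this]
    exact isClosed_iUnion_of_finite fun i =>
      ((h.continuousOn i).mono Icc_subset_Ici_self).preimage_isClosed_of_isClosed isClosed_Icc
        isClosed_Iic
  obtain ⟨τ, ⟨⟨hτ1, hτ2⟩, i, hi⟩, hτ⟩ :=
    (isCompact_Icc.of_isClosed_subset hcl (sep_subset _ _)).exists_isLeast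
      ⟨t, ⟨ht, le_rfl⟩, k, hk⟩
  have hpos : ∀ s ∈ Ioo t₀ τ, ∀ j, 0 ≤ y j s := fun s hs j => by
    by_contra! hj
    exact absurd (hτ ⟨⟨hs.1.le, hs.2.le.trans hτ2⟩, j, hj.le⟩) (not_le.2 hs.2)
  have := h.le_exp_mul hτ1 (fun s hs => ha s hs.1.le i) (fun s hs => hK s hs.1.le i) hpos
  have := mul_nonpos_of_nonneg_of_nonpos (Real.exp_pos (K * (τ - t₀))).le hi
  linarith [h0 i]

/-- Lower bounds are preserved by the consensus dynamics. -/
theorem le_of_le (h : IsConsensusSolution a D t₀ y) {K m : ℝ}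
    (ha : ∀ t, t₀ ≤ t → ∀ k j, 0 ≤ a t k j) (hK : ∀ t, t₀ ≤ t → ∀ k, ∑ j, a t k j ≤ K)
    (h0 : ∀ k, m ≤ y k t₀) {t : ℝ} (ht : t₀ ≤ t) (k : Fin N) : m ≤ y k t := by
  -- Shifting by `m - ε` makes the initial values strictly positive, as `pos_of_pos` needs.
  refine le_of_forall_pos_lt_add fun ε hε => ?_
  have := (h.sub_const (m - ε)).pos_of_pos ha hK (fun k => by linarith [h0 k]) ht k
  linarith

/-- Upper bounds are preserved by the consensus dynamics. -/
theorem ge_of_ge (h : IsConsensusSolution a D t₀ y) {K M : ℝ}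
    (ha : ∀ t, t₀ ≤ t → ∀ k j, 0 ≤ a t k j) (hK : ∀ t, t₀ ≤ t → ∀ k, ∑ j, a t k j ≤ K)
    (h0 : ∀ k, y k t₀ ≤ M) {t : ℝ} (ht : t₀ ≤ t) (k : Fin N) : y k t ≤ M :=
  neg_le_neg_iff.1 (h.neg.le_of_le ha hK (fun k => neg_le_neg (h0 k)) ht k)

/-- Transfer of mass along an edge whose integrated weight is at least `δ`. -/
theorem le_of_edge (h : IsConsensusSolution a D t₀ y) {K T δ β : ℝ} (hT : 0 ≤ T) (hK0 : 0 ≤ K)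
    (ha : ∀ t, t₀ ≤ t → ∀ k j, 0 ≤ a t k j) (hK : ∀ t, t₀ ≤ t → ∀ k, ∑ j, a t k j ≤ K)
    (h0 : ∀ k, 0 ≤ y k t₀) {i j : Fin N} (hβ : 0 ≤ β) (hj : β ≤ y j t₀)
    (hint : MeasureTheory.IntegrableOn (fun t => a t i j) (Icc t₀ (t₀ + T)))
    (hδ : δ ≤ ∫ t in t₀..(t₀ + T), a t i j) :
    Real.exp (-(2 * K * T)) * δ * β ≤ y i (t₀ + T) := by
  have hy : ∀ t, t₀ ≤ t → ∀ k, 0 ≤ y k t := fun t ht k => h.le_of_le ha hK h0 ht k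
  have key := h.integral_le_exp_mul_sub (k := i) (K := K) (t₁ := t₀ + T)
    -- Since `e^{K(t-t₀)} y_j(t) ≥ β`, the factor `e^{-KT}` here is pure slack; with the later
    -- division by `e^{KT}` it produces the exponent `2KT`.
    (φ := fun t => Real.exp (-(K * T)) * β * a t i j) (by linarith)
    (fun t ht => hK t ht.1.le i) (fun t ht => hy t ht.1.le i) (hint.const_mul _) fun t ht => by
      have h1 := h.le_exp_mul (k := j) (K := K) (t₁ := t) ht.1.le (fun s hs => ha s hs.1.le j)
        (fun s hs => hK s hs.1.le j) (fun s hs => hy s hs.1.le)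
      have h2 : Real.exp (-(K * T)) * β ≤ Real.exp (K * (t - t₀)) * y j t :=
        calc Real.exp (-(K * T)) * β ≤ 1 * β := by
              gcongr; exact Real.exp_le_one_iff.2 (by nlinarith)
          _ ≤ y j t₀ := by linarith
          _ ≤ _ := h1
      calc Real.exp (-(K * T)) * β * a t i j
          ≤ Real.exp (K * (t - t₀)) * y j t * a t i j :=
            mul_le_mul_of_nonneg_right h2 (ha t ht.1.le i j)
        _ = Real.exp (K * (t - t₀)) * (a t i j * y j t) := by ring
        _ ≤ _ := by
          gcongr
          exact Finset.single_le_sum (f := fun j => a t i j * y j t)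
            (fun l _ => mul_nonneg (ha t ht.1.le i l) (hy t ht.1.le l)) (Finset.mem_univ j)
  rw [intervalIntegral.integral_const_mul, add_sub_cancel_left] at key
  have h3 : Real.exp (-(K * T)) * β * δ ≤ Real.exp (K * T) * y i (t₀ + T) :=
    (mul_le_mul_of_nonneg_left hδ (by positivity)).trans (by linarith [h0 i])
  have h4 := mul_le_mul_of_nonneg_left h3 (Real.exp_pos (-(K * T))).le
  rw [← mul_assoc, ← mul_assoc, ← Real.exp_add, ← mul_assoc, ← Real.exp_add, neg_add_cancel,
    Real.exp_zero, one_mul] at h4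
  calc _ = Real.exp (-(K * T) + -(K * T)) * β * δ := by rw [mul_right_comm]; ring_nf
    _ ≤ _ := h4

end IsConsensusSolution

/-! ### Spreading from the root and contraction of the diameter -/

/-- A path leading into a set from outside it has a step that enters the set. -/
theorem Relation.ReflTransGen.exists_step_into {α : Type*} {r : α → α → Prop} {x z : α} {s : Set α}
    (h : Relation.ReflTransGen r x z) (hx : x ∉ s) (hz : z ∈ s) :
    ∃ i, i ∉ s ∧ ∃ j ∈ s, r i j := by
  induction h using Relation.ReflTransGen.head_induction_on with
  | refl => exact absurd hz hx
  | @head p q hpq _ ih =>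
    by_cases hq : q ∈ s
    · exact ⟨p, hx, q, hq, hpq⟩
    · exact ih hq

/-- The factor by which a positive lower bound shrinks while it spreads to one more node during a
time window of length `T`. -/
noncomputable def spreadFactor (K T δ : ℝ) : ℝ :=
  min (Real.exp (-(K * T))) (Real.exp (-(2 * K * T)) * δ)

theorem spreadFactor_pos {K T δ : ℝ} (hδ : 0 < δ) : 0 < spreadFactor K T δ :=
  lt_min (Real.exp_pos _) (by positivity)

theorem spreadFactor_le_one {K T δ : ℝ} (hK : 0 ≤ K) (hT : 0 ≤ T) : spreadFactor K T δ ≤ 1 :=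
  (min_le_left _ _).trans (Real.exp_le_one_iff.2 (neg_nonpos.2 (mul_nonneg hK hT)))

namespace IsConsensusSolution

variable {N : ℕ} {G : TimeVaryingDigraph N} {D : Set ℝ} {t₀ : ℝ} {y : Fin N → ℝ → ℝ}
  {K T δ : ℝ} {k₀ : Fin N}

/-- A positive lower bound at the root spreads to a growing set of nodes. -/
theorem exists_finset_spread (h : IsConsensusSolution G.adj D t₀ y) (ht₀ : 0 ≤ t₀) (hT : 0 ≤ T)
    (hδ : 0 < δ) (hK0 : 0 ≤ K) (hK : ∀ t, 0 ≤ t → ∀ k, ∑ j, G.adj t k j ≤ K)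
    (hint : ∀ i j s, 0 ≤ s → MeasureTheory.IntegrableOn (fun t => G.adj t i j) (Icc s (s + T)))
    (hconn : ∀ t, 0 ≤ t → ∀ j, j ≠ k₀ → G.ConnectedAcross δ t (t + T) j k₀)
    (h0 : ∀ k, 0 ≤ y k t₀) {β : ℝ} (hβ : 0 ≤ β) (hk₀ : β ≤ y k₀ t₀) (n : ℕ) :
    ∃ S : Finset (Fin N), k₀ ∈ S ∧ min (n + 1) N ≤ S.card ∧
      ∀ i ∈ S, spreadFactor K T δ ^ n * β ≤ y i (t₀ + n * T) := by
  have ha : ∀ t, t₀ ≤ t → ∀ k j, 0 ≤ G.adj t k j := fun t ht => G.adj_nonneg t (ht₀.trans ht)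
  have hK' : ∀ t, t₀ ≤ t → ∀ k, ∑ j, G.adj t k j ≤ K := fun t ht => hK t (ht₀.trans ht)
  have hy : ∀ t, t₀ ≤ t → ∀ k, 0 ≤ y k t := fun t ht k => h.le_of_le ha hK' h0 ht k
  induction n with
  | zero => exact ⟨{k₀}, by simp, by simp, by simpa using hk₀⟩
  | succ n ih =>
    obtain ⟨S, hS, hcard, hle⟩ := ih
    have hτ : t₀ ≤ t₀ + n * T := le_add_of_nonneg_right (by positivity)
    have hτ0 := ht₀.trans hτ
    have hst : t₀ + ((n + 1 : ℕ) : ℝ) * T = t₀ + n * T + T := by push_cast; ring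
    have hβ' : 0 ≤ spreadFactor K T δ ^ n * β :=
      mul_nonneg (pow_nonneg (spreadFactor_pos hδ).le n) hβ
    have hsol := h.mono hτ
    -- Nodes already reached lose at most the factor `e^{-KT}`, the first entry of the minimum in
    -- `spreadFactor`; the second pays for a new node.
    have hkeep : ∀ i ∈ S, spreadFactor K T δ ^ (n + 1) * β ≤ y i (t₀ + n * T + T) := by
      intro i hi
      have h1 := hsol.le_exp_mul (k := i) (K := K) (t₁ := t₀ + n * T + T) (by linarith)
        (fun t ht => ha t (hτ.trans ht.1.le) i) (fun t ht => hK' t (hτ.trans ht.1.le) i)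
        (fun t ht => hy t (hτ.trans ht.1.le))
      rw [add_sub_cancel_left] at h1
      calc spreadFactor K T δ ^ (n + 1) * β
          = spreadFactor K T δ * (spreadFactor K T δ ^ n * β) := by ring
        _ ≤ Real.exp (-(K * T)) * (Real.exp (K * T) * y i (t₀ + n * T + T)) :=
          mul_le_mul (min_le_left _ _) ((hle i hi).trans h1) hβ' (Real.exp_pos _).le
        _ = y i (t₀ + n * T + T) := by rw [← mul_assoc, ← Real.exp_add]; simp
    rw [hst]
    by_cases hall : ∃ x, x ∉ S
    · obtain ⟨x, hx⟩ := hall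
      -- A path from an unreached node to the root must enter `S`; its entering edge feeds a node
      -- outside `S` from one inside.
      obtain ⟨i, hi, j, hj, hij⟩ := (hconn _ hτ0 x (fun e => hx (e ▸ hS))).exists_step_into
        (s := (S : Set (Fin N))) (by simpa using hx) (by simpa using hS)
      have hi : i ∉ S := by simpa using hi
      refine ⟨insert i S, Finset.mem_insert_of_mem hS, ?_, fun l hl => ?_⟩
      · rw [Finset.card_insert_of_notMem hi]
        omega
      · rcases Finset.mem_insert.1 hl with rfl | hl
        · have h1 := hsol.le_of_edge hT hK0 (fun t ht => ha t (hτ.trans ht))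
            (fun t ht => hK' t (hτ.trans ht)) (hy _ hτ) hβ' (hle j (by simpa using hj))
            (hint l j _ hτ0) hij
          refine le_trans ?_ h1
          rw [pow_succ', mul_assoc]
          exact mul_le_mul_of_nonneg_right (min_le_right _ _) hβ'
        · exact hkeep l hl
    · push Not at hall
      refine ⟨S, hS, ?_, hkeep⟩
      rw [Finset.eq_univ_iff_forall.2 hall]
      simp

/-- If the root starts in the upper half of the interval `[m, M]`, all nodes move away from `m`
during `N` time windows. -/
theorem lower_bound_improves (h : IsConsensusSolution G.adj D t₀ y) (ht₀ : 0 ≤ t₀) (hT : 0 ≤ T)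
    (hδ : 0 < δ) (hK0 : 0 ≤ K) (hK : ∀ t, 0 ≤ t → ∀ k, ∑ j, G.adj t k j ≤ K)
    (hint : ∀ i j s, 0 ≤ s → MeasureTheory.IntegrableOn (fun t => G.adj t i j) (Icc s (s + T)))
    (hconn : ∀ t, 0 ≤ t → ∀ j, j ≠ k₀ → G.ConnectedAcross δ t (t + T) j k₀)
    {m β : ℝ} (h0 : ∀ k, m ≤ y k t₀) (hβ : 0 ≤ β) (hk₀ : m + β ≤ y k₀ t₀) (i : Fin N) :
    m + spreadFactor K T δ ^ N * β ≤ y i (t₀ + N * T) := by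
  obtain ⟨S, -, hcard, hle⟩ := (h.sub_const m).exists_finset_spread ht₀ hT hδ hK0 hK hint hconn
    (fun k => sub_nonneg.2 (h0 k)) hβ (by linarith) N
  have hS : S = Finset.univ := by
    rw [← Finset.card_eq_iff_eq_univ]
    refine le_antisymm (Finset.card_le_univ S) ?_
    simpa using hcard
  have := hle i (by simp [hS])
  linarith

/-- The diameter of the set of states does not increase. -/
theorem diam_le (h : IsConsensusSolution G.adj D t₀ y) (ht₀ : 0 ≤ t₀)
    (hK : ∀ t, 0 ≤ t → ∀ k, ∑ j, G.adj t k j ≤ K) {W : ℝ} (hW : ∀ i j, y i t₀ - y j t₀ ≤ W)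
    {t : ℝ} (ht : t₀ ≤ t) (i j : Fin N) : y i t - y j t ≤ W := by
  have : Nonempty (Fin N) := ⟨i⟩
  obtain ⟨p, hp⟩ := Finite.exists_min fun k => y k t₀
  obtain ⟨q, hq⟩ := Finite.exists_max fun k => y k t₀
  have h1 := h.le_of_le (fun t ht => G.adj_nonneg t (ht₀.trans ht))
    (fun t ht => hK t (ht₀.trans ht)) hp ht j
  have h2 := h.ge_of_ge (fun t ht => G.adj_nonneg t (ht₀.trans ht))
    (fun t ht => hK t (ht₀.trans ht)) hq ht i
  linarith [hW q p]

/-- The diameter of the set of states contracts during `N` time windows. -/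
theorem diam_contracts (h : IsConsensusSolution G.adj D t₀ y) (ht₀ : 0 ≤ t₀) (hT : 0 ≤ T)
    (hδ : 0 < δ) (hK0 : 0 ≤ K) (hK : ∀ t, 0 ≤ t → ∀ k, ∑ j, G.adj t k j ≤ K)
    (hint : ∀ i j s, 0 ≤ s → MeasureTheory.IntegrableOn (fun t => G.adj t i j) (Icc s (s + T)))
    (hconn : ∀ t, 0 ≤ t → ∀ j, j ≠ k₀ → G.ConnectedAcross δ t (t + T) j k₀)
    {W : ℝ} (hW : ∀ i j, y i t₀ - y j t₀ ≤ W) (i j : Fin N) :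
    y i (t₀ + N * T) - y j (t₀ + N * T) ≤ (1 - spreadFactor K T δ ^ N / 2) * W := by
  have : Nonempty (Fin N) := ⟨i⟩
  obtain ⟨p, hp⟩ := Finite.exists_min fun k => y k t₀
  obtain ⟨q, hq⟩ := Finite.exists_max fun k => y k t₀
  have ht : t₀ ≤ t₀ + N * T := le_add_of_nonneg_right (by positivity)
  have h1 := fun k => h.le_of_le (fun t ht => G.adj_nonneg t (ht₀.trans ht))
    (fun t ht => hK t (ht₀.trans ht)) hp ht k
  have h2 := fun k => h.ge_of_ge (fun t ht => G.adj_nonneg t (ht₀.trans ht))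
    (fun t ht => hK t (ht₀.trans ht)) hq ht k
  have hγ : spreadFactor K T δ ^ N ≤ 1 :=
    pow_le_one₀ (spreadFactor_pos hδ).le (spreadFactor_le_one hK0 hT)
  have hβ : 0 ≤ (y q t₀ - y p t₀) / 2 := by linarith [hq p]
  have key : y i (t₀ + N * T) - y j (t₀ + N * T) ≤
      (1 - spreadFactor K T δ ^ N / 2) * (y q t₀ - y p t₀) := by
    -- Either the root is at least half a diameter above the minimum, or it is so below the maximum
    -- and `-y` is used.
    rcases le_total ((y q t₀ + y p t₀) / 2) (y k₀ t₀) with hk | hk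
    · have := h.lower_bound_improves ht₀ hT hδ hK0 hK hint hconn hp hβ (by linarith) j
      linarith [h2 i]
    · have := h.neg.lower_bound_improves ht₀ hT hδ hK0 hK hint hconn
        (fun k => neg_le_neg (hq k)) hβ (by linarith) i
      linarith [h1 j]
  refine key.trans (mul_le_mul_of_nonneg_left (hW q p) (by linarith))

end IsConsensusSolution

/-! ### Exponential consensus of scalar states -/

namespace TimeVaryingDigraph

variable {N : ℕ} {G : TimeVaryingDigraph N}

/-- Exponential consensus for scalar states over a uniformly connected digraph. -/
theorem exists_consensus {K : ℝ} (hG : G.UniformlyConnected)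
    (hK : ∀ t, 0 ≤ t → ∀ k, ∑ j, G.adj t k j ≤ K)
    (hint : ∀ i j a b, 0 ≤ a → MeasureTheory.IntegrableOn (fun t => G.adj t i j) (Icc a b)) :
    ∃ c : ℝ, 0 < c ∧ ∃ r : ℝ, 0 < r ∧ ∀ t₀ : ℝ, 0 ≤ t₀ → ∀ (D : Set ℝ) (y : Fin N → ℝ → ℝ),
      IsConsensusSolution G.adj D t₀ y →
        ∃ z : ℝ, ∀ R : ℝ, (∀ k, |y k t₀ - z| ≤ R) →
          ∀ t, t₀ ≤ t → ∀ k, |y k t - z| ≤ c * Real.exp (-r * (t - t₀)) * R := by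
  obtain ⟨T, hT, δ, hδ, k₀, hconn⟩ := hG
  have hN : 0 < N := k₀.pos
  have hK0 : 0 ≤ K := (Finset.sum_nonneg fun j _ => G.adj_nonneg 0 le_rfl k₀ j).trans
    (hK 0 le_rfl k₀)
  set q := 1 - spreadFactor K T δ ^ N / 2 with hq
  have hγ : spreadFactor K T δ ^ N ≤ 1 :=
    pow_le_one₀ (spreadFactor_pos hδ).le (spreadFactor_le_one hK0 hT.le)
  have hγ0 : 0 < spreadFactor K T δ ^ N := pow_pos (spreadFactor_pos hδ) N
  have hq0 : 0 < q := by linarith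
  have hq1 : q < 1 := by linarith
  set P := N * T with hP
  have hP0 : 0 < P := by positivity
  have hr : 0 < -Real.log q / P := div_pos (neg_pos.2 (Real.log_neg hq0 hq1)) hP0
  -- The rate solves `e^{-rP} = q`. The factor `q⁻¹` pays for the incomplete last period, and `2`
  -- for bounding the initial diameter by `2R`.
  refine ⟨2 * q⁻¹, by positivity, -Real.log q / P, hr, fun t₀ ht₀ D y hy => ?_⟩
  have hiter : ∀ W, (∀ i j, y i t₀ - y j t₀ ≤ W) → ∀ n : ℕ, ∀ i j,
      y i (t₀ + n * P) - y j (t₀ + n * P) ≤ q ^ n * W := by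
    intro W hW n
    induction n with
    | zero => simpa using hW
    | succ n ih =>
      intro i j
      have hle : t₀ ≤ t₀ + n * P := le_add_of_nonneg_right (by positivity)
      have := (hy.mono hle).diam_contracts (ht₀.trans hle) hT.le hδ hK0 hK
        (fun i j s hs => hint i j s _ hs) hconn ih i j
      rw [← hP, ← hq] at this
      have e : t₀ + ((n + 1 : ℕ) : ℝ) * P = t₀ + n * P + P := by push_cast; ring
      rw [e]
      linarith [pow_succ' q n ▸ mul_assoc q (q ^ n) W]
  have hdecay : ∀ W, (∀ i j, y i t₀ - y j t₀ ≤ W) → ∀ t, t₀ ≤ t → ∀ i j,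
      y i t - y j t ≤ q⁻¹ * Real.exp (-(-Real.log q / P) * (t - t₀)) * W := by
    intro W hW t ht i j
    have hW0 : 0 ≤ W := by simpa using hW k₀ k₀
    set n := ⌊(t - t₀) / P⌋₊ with hn
    have hn1 : n * P ≤ t - t₀ := by
      rw [← le_div_iff₀ hP0]
      exact Nat.floor_le (div_nonneg (sub_nonneg.2 ht) hP0.le)
    have hn2 : (t - t₀) / P - 1 ≤ n := by linarith [Nat.lt_floor_add_one ((t - t₀) / P)]
    have hle : t₀ ≤ t₀ + n * P := le_add_of_nonneg_right (by positivity)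
    refine ((hy.mono hle).diam_le (ht₀.trans hle) hK (hiter W hW n) (by linarith) i j).trans ?_
    refine mul_le_mul_of_nonneg_right ?_ hW0
    have e1 : q ^ n = Real.exp (n * Real.log q) := by rw [Real.exp_nat_mul, Real.exp_log hq0]
    have e2 : q⁻¹ = Real.exp (-Real.log q) := by rw [Real.exp_neg, Real.exp_log hq0]
    rw [e1, e2, ← Real.exp_add, Real.exp_le_exp]
    have := mul_le_mul_of_nonpos_right hn2 (Real.log_neg hq0 hq1).le
    calc _ ≤ _ := this
      _ = _ := by ring
  have : Nonempty (Fin N) := ⟨k₀⟩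
  have ha : ∀ s, t₀ ≤ s → ∀ t, s ≤ t → ∀ k j, 0 ≤ G.adj t k j :=
    fun s hs t ht => G.adj_nonneg t (ht₀.trans (hs.trans ht))
  have hK' : ∀ s, t₀ ≤ s → ∀ t, s ≤ t → ∀ k, ∑ j, G.adj t k j ≤ K :=
    fun s hs t ht => hK t (ht₀.trans (hs.trans ht))
  -- The supremum of all lower bounds ever valid is the limit of the nondecreasing minimum. It lies
  -- between minimum and maximum at every time, so the diameter bounds the distance to it and no
  -- convergence argument is needed.
  let A : Set ℝ := {m | ∃ s, t₀ ≤ s ∧ ∀ k, m ≤ y k s}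
  have hub : ∀ t, t₀ ≤ t → ∀ i, (∀ k, y k t ≤ y i t) → y i t ∈ upperBounds A := by
    rintro t ht i hi m ⟨s, hs, hm⟩
    have h1 := (hy.mono hs).le_of_le (ha s hs) (hK' s hs) hm (le_max_left s t) i
    have h2 := (hy.mono ht).ge_of_ge (ha t ht) (hK' t ht) hi (le_max_right s t) i
    exact h1.trans h2
  have hbdd : BddAbove A := by
    obtain ⟨i, hi⟩ := Finite.exists_max fun k => y k t₀
    exact ⟨_, hub t₀ le_rfl i hi⟩
  have hz : ∀ t, t₀ ≤ t → ∃ i j, y j t ≤ sSup A ∧ sSup A ≤ y i t := by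
    intro t ht
    obtain ⟨i, hi⟩ := Finite.exists_max fun k => y k t
    obtain ⟨j, hj⟩ := Finite.exists_min fun k => y k t
    have hjA : y j t ∈ A := ⟨t, ht, hj⟩
    exact ⟨i, j, le_csSup hbdd hjA, csSup_le ⟨_, hjA⟩ fun m hm => hub t ht i hi hm⟩
  refine ⟨sSup A, fun R hR t ht k => ?_⟩
  have hd := hdecay (2 * R) (fun i j => by
    have h1 := abs_le.1 (hR i)
    have h2 := abs_le.1 (hR j)
    linarith [h1.2, h2.1]) t ht
  obtain ⟨i, j, hj, hi⟩ := hz t ht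
  rw [abs_le]
  constructor <;> linarith [hd i k, hd k j]

end TimeVaryingDigraph

/-! ### Subexponential growth of the matrix exponential -/

section Exponential

/-- A bounded (semi)linear map that intertwines two bounded operators intertwines their
exponentials. -/
theorem ContinuousLinearMap.exp_apply_comm {𝕜 𝕜' E F : Type*} [RCLike 𝕜] [RCLike 𝕜']
    [NormedAddCommGroup E] [NormedSpace 𝕜 E] [CompleteSpace E]
    [NormedAddCommGroup F] [NormedSpace 𝕜' F] [CompleteSpace F]
    {σ : 𝕜 →+* 𝕜'} (J : E →SL[σ] F) (L : E →L[𝕜] E) (T : F →L[𝕜'] F)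
    (h : ∀ v, T (J v) = J (L v)) (v : E) :
    NormedSpace.exp T (J v) = J (NormedSpace.exp L v) := by
  have hpow : ∀ (n : ℕ) v, (T ^ n) (J v) = J ((L ^ n) v) := by
    intro n
    induction n with
    | zero => simp
    | succ n ih => intro v; rw [pow_succ, pow_succ, mul_apply_eq_comp, mul_apply_eq_comp, h, ih]
  have h1 := (NormedSpace.exp_series_hasSum_exp' (𝕂 := 𝕜') T).mapL
    (ContinuousLinearMap.apply 𝕜' F (J v))
  have h2 := ((NormedSpace.exp_series_hasSum_exp' (𝕂 := 𝕜) L).mapL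
    (ContinuousLinearMap.apply 𝕜 E v)).mapL J
  refine h1.unique (h2.congr_fun fun n => ?_)
  simp [hpow, map_inv₀]

variable {E : Type*} [NormedAddCommGroup E] [NormedSpace ℂ E] [FiniteDimensional ℂ E]

/-- Each eigenspace of `e^T` is invariant under `T`, hence contains an eigenvector of `T`, for some
`z`. So the eigenvalue of `e^T` is `e^z`, of modulus `e^{Re z} ≤ 1`. -/
theorem spectralRadius_exp_le_one (T : E →L[ℂ] E)
    (hT : ∀ μ : ℂ, Module.End.HasEigenvalue (T : Module.End ℂ E) μ → μ.re ≤ 0) :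
    spectralRadius ℂ (NormedSpace.exp T) ≤ 1 := by
  have : CompleteSpace E := FiniteDimensional.complete ℂ E
  refine iSup₂_le fun μ hμ => ?_
  set S : Module.End ℂ E := ((NormedSpace.exp T : E →L[ℂ] E) : E →ₗ[ℂ] E) with hS
  have hev : S.HasEigenvalue μ := by
    rwa [Module.End.hasEigenvalue_iff_mem_spectrum, hS, ← ContinuousLinearMap.spectrum_eq]
  have hcomm : Commute S (T : Module.End ℂ E) := by
    have : Commute (NormedSpace.exp T) T := (Commute.refl T).exp_left
    exact LinearMap.ext fun v => DFunLike.congr_fun this.eq v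
  have hmaps : MapsTo (T : Module.End ℂ E) (S.eigenspace μ) (S.eigenspace μ) :=
    Module.End.mapsTo_genEigenspace_of_comm hcomm μ 1
  have : Nontrivial (S.eigenspace μ) := (Submodule.nontrivial_iff_ne_bot).2 hev
  obtain ⟨z, hz⟩ := Module.End.exists_eigenvalue ((T : Module.End ℂ E).restrict hmaps)
  obtain ⟨v, hv, hv0⟩ := hz.exists_hasEigenvector
  have hTv : T v = z • (v : E) := congrArg Subtype.val (Module.End.mem_eigenspace_iff.1 hv)
  have hv0' : (v : E) ≠ 0 := by simpa using hv0
  have hzre : z.re ≤ 0 := hT z (Module.End.hasEigenvalue_of_hasEigenvector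
    ⟨Module.End.mem_eigenspace_iff.2 hTv, hv0'⟩)
  -- The map `w ↦ w • v` intertwines multiplication by `z` on `ℂ` with `T`, which gives `e^T v = e^z
  -- v`.
  have h1 := ContinuousLinearMap.exp_apply_comm (ContinuousLinearMap.toSpanSingleton ℂ (v : E))
    (z • (1 : ℂ →L[ℂ] ℂ)) T (fun w => by simp [hTv, smul_smul, mul_comm]) 1
  have h2 : S v = μ • (v : E) := Module.End.mem_eigenspace_iff.1 v.2
  have h3 : NormedSpace.exp (z • (1 : ℂ →L[ℂ] ℂ)) = NormedSpace.exp z • 1 := by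
    rw [← Algebra.algebraMap_eq_smul_one, ← Algebra.algebraMap_eq_smul_one,
      NormedSpace.algebraMap_exp_comm]
  have h4 : S v = NormedSpace.exp z • (v : E) := by simpa [h3, hS] using h1
  have h5 : μ = Complex.exp z := by
    rw [Complex.exp_eq_exp_ℂ]
    exact smul_left_injective ℂ hv0' (h2.symm.trans h4)
  have h6 : ‖μ‖ ≤ 1 := by rw [h5, Complex.norm_exp]; exact Real.exp_le_one_iff.2 hzre
  exact_mod_cast h6

/-- The exponential of an operator without eigenvalues in the right half plane grows slower than
every exponential. -/
theorem exists_norm_exp_smul_le_of_complex (T : E →L[ℂ] E)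
    (hT : ∀ μ : ℂ, Module.End.HasEigenvalue (T : Module.End ℂ E) μ → μ.re ≤ 0)
    {ε : ℝ} (hε : 0 < ε) :
    ∃ C : ℝ, 0 < C ∧ ∀ t : ℝ, 0 ≤ t →
      ‖NormedSpace.exp ((t : ℂ) • T)‖ ≤ C * Real.exp (ε * t) := by
  have : CompleteSpace E := FiniteDimensional.complete ℂ E
  let +nondep : NormedAlgebra ℚ (E →L[ℂ] E) := .restrictScalars ℚ ℂ _
  obtain ⟨C₁, hC₁⟩ : ∃ C, ∀ k : ℕ, ‖NormedSpace.exp T ^ k‖ ≤ C * Real.exp (ε * k) := by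
    have hlim := spectrum.pow_norm_pow_one_div_tendsto_nhds_spectralRadius (NormedSpace.exp T)
    have hlt : spectralRadius ℂ (NormedSpace.exp T) < ENNReal.ofReal (Real.exp ε) :=
      (spectralRadius_exp_le_one T hT).trans_lt (by simpa using hε)
    obtain ⟨n₀, hn₀⟩ := eventually_atTop.1
      ((hlim.eventually_lt_const hlt).and (eventually_ge_atTop 1))
    -- Gelfand's formula gives `‖e^{kT}‖ ≤ e^{εk}` for `k ≥ n₀`; the sum absorbs the remaining
    -- powers.
    refine ⟨1 + ∑ k ∈ Finset.range n₀, ‖NormedSpace.exp T ^ k‖, fun k => ?_⟩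
    have hS : 0 ≤ ∑ k ∈ Finset.range n₀, ‖NormedSpace.exp T ^ k‖ :=
      Finset.sum_nonneg fun _ _ => norm_nonneg _
    have he : 1 ≤ Real.exp (ε * k) := Real.one_le_exp (by positivity)
    rcases lt_or_ge k n₀ with hk | hk
    · have h1 := Finset.single_le_sum (f := fun k => ‖NormedSpace.exp T ^ k‖)
        (fun _ _ => norm_nonneg _) (Finset.mem_range.2 hk)
      nlinarith
    · obtain ⟨h1, h2⟩ := hn₀ k hk
      have h3 := (ENNReal.ofReal_lt_ofReal_iff (Real.exp_pos _)).1 h1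
      have hk0 : (k : ℝ) ≠ 0 := by positivity
      have h4 := pow_le_pow_left₀ (by positivity) h3.le k
      rw [← Real.rpow_natCast, ← Real.rpow_mul (norm_nonneg _), one_div_mul_cancel hk0,
        Real.rpow_one, ← Real.exp_nat_mul, mul_comm] at h4
      nlinarith
  obtain ⟨C₂, hC₂⟩ : ∃ C, ∀ s ∈ Icc (0 : ℝ) 1, ‖NormedSpace.exp ((s : ℂ) • T)‖ ≤ C := by
    have hc : Continuous fun s : ℝ => NormedSpace.exp ((s : ℂ) • T) :=
      NormedSpace.exp_continuous.comp (by fun_prop)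
    exact isCompact_Icc.exists_bound_of_continuousOn hc.continuousOn
  have hC₁0 : 0 ≤ C₁ := by simpa using (norm_nonneg _).trans (hC₁ 0)
  have hC₂0 : 0 ≤ C₂ := (norm_nonneg _).trans (hC₂ 0 (by simp))
  refine ⟨C₁ * C₂ + 1, by positivity, fun t ht => ?_⟩
  set k := ⌊t⌋₊
  have hk1 : (k : ℝ) ≤ t := Nat.floor_le ht
  have hk2 : t < k + 1 := Nat.lt_floor_add_one t
  have hsplit : (t : ℂ) • T = k • T + ((t - k : ℝ) : ℂ) • T := by
    rw [← Nat.cast_smul_eq_nsmul ℂ, ← add_smul]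
    congr 1
    push_cast
    ring
  rw [hsplit, NormedSpace.exp_add_of_commute
    (((Commute.refl T).smul_left k).smul_right ((t - k : ℝ) : ℂ)), NormedSpace.exp_nsmul]
  calc ‖NormedSpace.exp T ^ k * NormedSpace.exp (((t - k : ℝ) : ℂ) • T)‖
      ≤ (C₁ * Real.exp (ε * k)) * C₂ :=
        (norm_mul_le _ _).trans (mul_le_mul (hC₁ k) (hC₂ _ ⟨by linarith, by linarith⟩)
          (norm_nonneg _) (by positivity))
    _ = C₁ * C₂ * Real.exp (ε * k) := by ring
    _ ≤ (C₁ * C₂ + 1) * Real.exp (ε * t) := by gcongr; linarith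

end Exponential

/-- The coordinatewise embedding of a real Euclidean space into the complex one. -/
noncomputable def EuclideanSpace.complexify (n : ℕ) :
    EuclideanSpace ℝ (Fin n) →SL[Complex.ofRealHom] EuclideanSpace ℂ (Fin n) :=
  LinearMap.mkContinuous
    { toFun := fun v => WithLp.toLp 2 fun i => (v i : ℂ)
      map_add' := fun v w => by ext i; simp
      map_smul' := fun c v => by ext i; simp } 1
    fun v => by simp [EuclideanSpace.norm_eq]

theorem EuclideanSpace.norm_complexify {n : ℕ} (v : EuclideanSpace ℝ (Fin n)) :
    ‖EuclideanSpace.complexify n v‖ = ‖v‖ := by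
  simp [EuclideanSpace.norm_eq, EuclideanSpace.complexify]

/-- The norm-preserving embedding into `ℂⁿ` intertwines the real and complex exponentials, so the
complex bound carries over. -/
theorem exists_norm_exp_smul_le {n : ℕ} {A : Matrix (Fin n) (Fin n) ℝ}
    (hA : EigenvaluesImaginary A) {ε : ℝ} (hε : 0 < ε) :
    ∃ C : ℝ, 0 < C ∧ ∀ t : ℝ, 0 ≤ t → ∀ v : EuclideanSpace ℝ (Fin n),
      ‖NormedSpace.exp (t • Matrix.toEuclideanCLM (𝕜 := ℝ) A) v‖ ≤ C * Real.exp (ε * t) * ‖v‖ := by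
  set T := Matrix.toEuclideanCLM (𝕜 := ℂ) (A.map (algebraMap ℝ ℂ)) with hT
  obtain ⟨C, hC, hbound⟩ := exists_norm_exp_smul_le_of_complex T (fun μ hμ => by
    obtain ⟨v, hv, hv0⟩ := hμ.exists_hasEigenvector
    refine (hA μ (Module.End.hasEigenvalue_of_hasEigenvector (x := WithLp.ofLp v) ⟨?_, ?_⟩)).le
    · rw [Module.End.mem_eigenspace_iff] at hv ⊢
      exact congrArg WithLp.ofLp hv
    · simpa using hv0) hε
  refine ⟨C, hC, fun t ht v => ?_⟩
  have key := ContinuousLinearMap.exp_apply_comm (EuclideanSpace.complexify n)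
    (t • Matrix.toEuclideanCLM (𝕜 := ℝ) A) ((t : ℂ) • T) (fun w => by
      ext i
      simp [hT, EuclideanSpace.complexify, Matrix.mulVec, dotProduct]) v
  rw [← EuclideanSpace.norm_complexify, ← key, ← EuclideanSpace.norm_complexify v]
  exact ContinuousLinearMap.le_of_opNorm_le _ (hbound t ht) _

theorem hasDerivAt_exp_sub_smul {E : Type*} [NormedAddCommGroup E] [NormedSpace ℝ E]
    [CompleteSpace E] (L : E →L[ℝ] E) (s t : ℝ) :
    HasDerivAt (fun t : ℝ => NormedSpace.exp ((t - s) • L))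
      (L * NormedSpace.exp ((t - s) • L)) t := by
  have h := (hasDerivAt_exp_smul_const' (𝕂 := ℝ) L (t - s)).scomp t
    ((hasDerivAt_id t).sub_const s)
  rw [one_smul] at h
  exact h

theorem exp_sub_self_smul_apply {E : Type*} [NormedAddCommGroup E] [NormedSpace ℝ E]
    (L : E →L[ℝ] E) (s : ℝ) (v : E) : NormedSpace.exp ((s - s) • L) v = v := by
  rw [sub_self, zero_smul, NormedSpace.exp_zero, one_apply_eq_self]

theorem mul_exp_smul_comm {E : Type*} [NormedAddCommGroup E] [NormedSpace ℝ E]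
    (L : E →L[ℝ] E) (t : ℝ) :
    L * NormedSpace.exp (t • L) = NormedSpace.exp (t • L) * L :=
  ((Commute.refl L).smul_right t).exp_right.eq

theorem exp_smul_apply_exp_neg_smul {E : Type*} [NormedAddCommGroup E] [NormedSpace ℝ E]
    [CompleteSpace E] (L : E →L[ℝ] E) (t : ℝ) (v : E) :
    NormedSpace.exp (t • L) (NormedSpace.exp (t • -L) v) = v := by
  let +nondep : NormedAlgebra ℚ (E →L[ℝ] E) := .restrictScalars ℚ ℝ _
  have hc : Commute (t • L) (t • -L) :=
    (((Commute.refl L).neg_right).smul_left t).smul_right t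
  have := NormedSpace.exp_add_of_commute hc
  rw [smul_neg, add_neg_cancel, NormedSpace.exp_zero, ← smul_neg] at this
  exact (DFunLike.congr_fun this v).symm

/-! ### Integrability of the weights and reduction to scalar consensus -/

namespace TimeVaryingDigraph

variable {N : ℕ} (G : TimeVaryingDigraph N)

theorem adj_eq_neg_laplacian {k j : Fin N} (h : j ≠ k) (t : ℝ) :
    G.adj t k j = - G.laplacian t k j := by
  simp [laplacian, h]

theorem sum_adj_eq_laplacian (k : Fin N) (t : ℝ) :
    ∑ j, G.adj t k j = G.laplacian t k k := by
  simp [laplacian]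

variable {G}

open MeasureTheory in
/-- The weights of a digraph with bounded, piecewise continuous Laplacian are integrable. -/
theorem integrableOn_adj (hpc : PiecewiseContinuous G.laplacian) (hbdd : G.LaplacianBounded)
    (i j : Fin N) {a b : ℝ} (ha : 0 ≤ a) :
    IntegrableOn (fun t => G.adj t i j) (Icc a b) := by
  -- A diagonal Laplacian entry is a row sum, not a weight, so the zero diagonal weights are treated
  -- apart.
  rcases eq_or_ne j i with rfl | hij
  · exact integrableOn_zero.congr_fun
      (fun t ht => (G.adj_self t (ha.trans ht.1) _).symm) measurableSet_Icc
  obtain ⟨M, hM⟩ := hbdd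
  simp_rw [G.adj_eq_neg_laplacian hij]
  refine Integrable.neg ?_
  set F := {t : ℝ | 0 ≤ t ∧ t ≤ b ∧ ¬ ContinuousWithinAt G.laplacian (Ici 0) t} with hF
  have hFfin : F.Finite := hpc.1 b
  have hcont : ContinuousOn (fun t => G.laplacian t i j) (Icc a b \ F) := by
    intro t ht
    have h1 : ContinuousWithinAt G.laplacian (Ici 0) t := by
      by_contra h
      exact ht.2 ⟨ha.trans ht.1.1, ht.1.2, h⟩
    have h2 : ContinuousWithinAt G.laplacian (Icc a b \ F) t :=
      h1.mono fun s hs => ha.trans hs.1.1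
    exact (((continuous_apply j).comp (continuous_apply i)).continuousAt).comp_continuousWithinAt h2
  have hae : (Icc a b \ F : Set ℝ) =ᵐ[volume] Icc a b :=
    sdiff_null_ae_eq_self (hFfin.measure_zero volume)
  have hmeas : AEStronglyMeasurable (fun t => G.laplacian t i j) (volume.restrict (Icc a b)) := by
    rw [← Measure.restrict_congr_set hae]
    exact hcont.aestronglyMeasurable (measurableSet_Icc.diff hFfin.measurableSet)
  refine IntegrableOn.of_bound (C := M) (by simp) hmeas ?_
  refine (ae_restrict_iff' measurableSet_Icc).2 (ae_of_all _ fun t ht => ?_)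
  exact hM t (ha.trans ht.1) i j

end TimeVaryingDigraph

/-- In the coordinates rotating with the open-loop dynamics, every component of a closed-loop
solution solves the scalar consensus equations. -/
theorem IsClosedLoopSolution.exists_isConsensusSolution {N n : ℕ} {A B : Matrix (Fin n) (Fin n) ℝ}
    {G : TimeVaryingDigraph N} (hB : IsUnit B.det) {t₀ : ℝ}
    {x : Fin N → ℝ → EuclideanSpace ℝ (Fin n)} (hx : IsClosedLoopSolution A B G t₀ x) :
    ∃ D : Set ℝ, ∀ i, IsConsensusSolution G.adj D t₀ fun k t =>
      NormedSpace.exp ((t - t₀) • -Matrix.toEuclideanCLM (𝕜 := ℝ) A) (x k t) i := by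
  choose hcont D hfin hderiv using hx
  set L := Matrix.toEuclideanCLM (𝕜 := ℝ) A with hL
  refine ⟨⋃ k, D k, fun i => ⟨fun b => ?_, fun k => ?_, fun k t ht htD => ?_⟩⟩
  · rw [iUnion_inter]
    exact finite_iUnion fun k => hfin k b
  · have h1 : Continuous fun t : ℝ => NormedSpace.exp ((t - t₀) • -L) :=
      continuous_iff_continuousAt.2 fun t => (hasDerivAt_exp_sub_smul (-L) t₀ t).continuousAt
    exact (EuclideanSpace.proj (𝕜 := ℝ) i).continuous.comp_continuousOn
      (h1.continuousOn.clm_apply (hcont k))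
  · have h1 := hderiv k t ht fun h => htD (mem_iUnion.2 ⟨k, h⟩)
    have hBB : Matrix.toEuclideanLin B (diffusiveControl B G x k t) =
        ∑ j, G.adj t k j • (x j t - x k t) := by
      have : ∀ v, Matrix.toEuclideanLin B (Matrix.toEuclideanLin B⁻¹ v) = v := fun v => by
        ext l
        simp [Matrix.mulVec_mulVec, Matrix.mul_nonsing_inv B hB]
      exact this _
    rw [hBB] at h1
    have h2 := (hasDerivAt_exp_sub_smul (-L) t₀ t).clm_apply h1
    -- This term cancels the drift `A x_k`, leaving only the coupling.
    have hcomm : (-L * NormedSpace.exp ((t - t₀) • -L)) (x k t) =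
        - NormedSpace.exp ((t - t₀) • -L) (Matrix.toEuclideanLin A (x k t)) := by
      rw [mul_exp_smul_comm, mul_apply_eq_comp, neg_apply,
        map_neg]
      rfl
    have h3 := (EuclideanSpace.proj (𝕜 := ℝ) i).hasFDerivAt.comp_hasDerivAt t h2
    refine h3.congr_deriv ?_
    rw [hcomm, map_add (NormedSpace.exp ((t - t₀) • -L)), neg_add_cancel_left, map_sum, map_sum]
    exact Finset.sum_congr rfl fun j _ => by
      rw [map_smul, map_sub, map_smul, map_sub]
      rfl

theorem isOpenLoopSolution_exp {n : ℕ} (A : Matrix (Fin n) (Fin n) ℝ) (s : ℝ)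
    (z : EuclideanSpace ℝ (Fin n)) : IsOpenLoopSolution A fun t =>
      NormedSpace.exp ((t - s) • Matrix.toEuclideanCLM (𝕜 := ℝ) A) z := fun t => by
  have h := (hasDerivAt_exp_sub_smul (Matrix.toEuclideanCLM (𝕜 := ℝ) A) s t).clm_apply
    (hasDerivAt_const t z)
  rw [map_zero, add_zero] at h
  exact h

/-! ### Norm comparisons and the synchronization theorem -/

theorem norm_le_stackNorm {N n : ℕ} (v : Fin N → EuclideanSpace ℝ (Fin n)) (k : Fin N) :
    ‖v k‖ ≤ stackNorm v :=
  Real.le_sqrt_of_sq_le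
    (Finset.single_le_sum (f := fun k => ‖v k‖ ^ 2) (fun _ _ => sq_nonneg _) (Finset.mem_univ k))

theorem stackNorm_le {N n : ℕ} {v : Fin N → EuclideanSpace ℝ (Fin n)} {R : ℝ} (hR : 0 ≤ R)
    (h : ∀ k, ‖v k‖ ≤ R) : stackNorm v ≤ √N * R := by
  rw [stackNorm, ← Real.sqrt_sq hR, ← Real.sqrt_mul (Nat.cast_nonneg N)]
  refine Real.sqrt_le_sqrt ((Finset.sum_le_card_nsmul _ _ (R ^ 2) fun k _ =>
    pow_le_pow_left₀ (norm_nonneg _) (h k) 2).trans ?_)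
  simp

theorem EuclideanSpace.norm_le_sqrt_mul {n : ℕ} {v : EuclideanSpace ℝ (Fin n)} {R : ℝ} (hR : 0 ≤ R)
    (h : ∀ i, |v i| ≤ R) : ‖v‖ ≤ √n * R := by
  rw [EuclideanSpace.norm_eq, ← Real.sqrt_sq hR, ← Real.sqrt_mul (Nat.cast_nonneg n)]
  refine Real.sqrt_le_sqrt ((Finset.sum_le_card_nsmul _ _ (R ^ 2) fun i _ =>
    pow_le_pow_left₀ (norm_nonneg _) (h i) 2).trans ?_)
  simp

theorem mainTheorem3 {N n : ℕ} (A B : Matrix (Fin n) (Fin n) ℝ) (G : TimeVaryingDigraph N)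
    (hB : IsUnit B.det)
    (hA : EigenvaluesImaginary A)
    (hG : G.UniformlyConnected)
    (hLpc : PiecewiseContinuous G.laplacian)
    (hLbdd : G.LaplacianBounded) :
    ∃ c : ℝ, 0 < c ∧ ∃ r : ℝ, 0 < r ∧
      ∀ t₀ : ℝ, 0 ≤ t₀ → ∀ x : Fin N → ℝ → EuclideanSpace ℝ (Fin n),
        IsClosedLoopSolution A B G t₀ x →
          ∃ x₀ : ℝ → EuclideanSpace ℝ (Fin n), IsOpenLoopSolution A x₀ ∧
            ∀ t : ℝ, t₀ ≤ t →
              stackNorm (fun k => x k t - x₀ t) ≤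
                c * Real.exp (-r * (t - t₀)) * stackNorm (fun k => x k t₀ - x₀ t₀) := by
  have hK : ∃ K : ℝ, ∀ t, 0 ≤ t → ∀ k, ∑ j, G.adj t k j ≤ K := by
    obtain ⟨M, hM⟩ := hLbdd
    exact ⟨M, fun t ht k => (G.sum_adj_eq_laplacian k t).trans_le
      ((le_abs_self _).trans (hM t ht k k))⟩
  obtain ⟨K, hK⟩ := hK
  obtain ⟨c, hc, r, hr, hcons⟩ := TimeVaryingDigraph.exists_consensus hG hK
    fun i j a b ha => TimeVaryingDigraph.integrableOn_adj hLpc hLbdd i j ha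
  obtain ⟨C, hC, hexp⟩ := exists_norm_exp_smul_le hA (half_pos hr)
  -- `√n` passes from coordinates to vectors and `√N` from nodes to the stack; `+ 1` keeps the
  -- constant positive when `n = 0`.
  refine ⟨√N * (C * √n * c) + 1, by positivity, r / 2, half_pos hr, fun t₀ ht₀ x hx => ?_⟩
  set L := Matrix.toEuclideanCLM (𝕜 := ℝ) A with hL
  obtain ⟨D, hD⟩ := hx.exists_isConsensusSolution hB
  -- The coordinatewise consensus values form the initial state at `t₀` of the reference solution.
  choose z hz using fun i => hcons t₀ ht₀ D _ (hD i)
  refine ⟨fun t => NormedSpace.exp ((t - t₀) • L) (WithLp.toLp 2 z),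
    isOpenLoopSolution_exp A t₀ _, fun t ht => ?_⟩
  have h0 : NormedSpace.exp ((t₀ - t₀) • L) (WithLp.toLp 2 z) = WithLp.toLp 2 z :=
    exp_sub_self_smul_apply L t₀ _
  simp only [h0]
  set S := stackNorm fun k => x k t₀ - WithLp.toLp 2 z with hS
  have hS0 : 0 ≤ S := Real.sqrt_nonneg _
  have ht' : 0 ≤ t - t₀ := sub_nonneg.2 ht
  have hinit : ∀ i k, |NormedSpace.exp ((t₀ - t₀) • -L) (x k t₀) i - z i| ≤ S := fun i k => by
    refine le_trans ?_ (norm_le_stackNorm (fun k => x k t₀ - WithLp.toLp 2 z) k)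
    rw [exp_sub_self_smul_apply]
    exact PiLp.norm_apply_le (x k t₀ - WithLp.toLp 2 z) i
  have hmain : ∀ k, ‖x k t - NormedSpace.exp ((t - t₀) • L) (WithLp.toLp 2 z)‖ ≤
      C * √n * c * Real.exp (-(r / 2) * (t - t₀)) * S := by
    intro k
    have e : x k t - NormedSpace.exp ((t - t₀) • L) (WithLp.toLp 2 z) =
        NormedSpace.exp ((t - t₀) • L)
          (NormedSpace.exp ((t - t₀) • -L) (x k t) - WithLp.toLp 2 z) := by
      rw [map_sub, exp_smul_apply_exp_neg_smul]
    have h1 := EuclideanSpace.norm_le_sqrt_mul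
      (v := NormedSpace.exp ((t - t₀) • -L) (x k t) - WithLp.toLp 2 z)
      (R := c * Real.exp (-r * (t - t₀)) * S) (by positivity)
      fun i => hz i S (hinit i) t ht k
    have he : Real.exp (r / 2 * (t - t₀)) * Real.exp (-r * (t - t₀)) =
        Real.exp (-(r / 2) * (t - t₀)) := by
      rw [← Real.exp_add]
      ring_nf
    rw [e]
    calc _ ≤ C * Real.exp (r / 2 * (t - t₀)) * (√n * (c * Real.exp (-r * (t - t₀)) * S)) :=
          (hexp _ ht' _).trans (mul_le_mul_of_nonneg_left h1 (by positivity))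
      _ = C * √n * c * (Real.exp (r / 2 * (t - t₀)) * Real.exp (-r * (t - t₀))) * S := by ring
      _ = _ := by rw [he]
  calc _ ≤ √N * (C * √n * c * Real.exp (-(r / 2) * (t - t₀)) * S) :=
        stackNorm_le (by positivity) hmain
    _ = √N * (C * √n * c) * Real.exp (-(r / 2) * (t - t₀)) * S := by ring
    _ ≤ _ := by gcongr; linarith
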